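/- Let $k$ and $i$ be integers with $1\le i\le k$. For $n,m\ge 0$ let $F_{k,i}(n,m)$ be the number of partitions $p_1\ge p_2\ge\cdots\ge p_m\ge 1$ of $n=\sum_l p_l$ into exactly $m$ parts such that $p_l\ge p_{l+k-1}+2$ whenever $1\le l$ and $l+k-1\le m$, and such that $p_{m-i+1}\ge 2$ if $i\le m$ (that is, at most $i-1$ parts are equal to $1$). Let $G_{k,i}(n,m)$ be the number of $(k-1)$-tuples $(n^{(1)},\dots,n^{(k-1)})$ of finite, possibly empty, sequences of positive integers $n^{(j)}=(n^{(j)}_1,\dots,n^{(j)}_{m_j})$, of arbitrary lengths $m_j\ge 0$, such that for every $1\le j\le k-1$ $$n^{(j)}_l\ge n^{(j)}_{l+1}+2j\quad(1\le l<m_j),\qquad n^{(j)}_{m_j}\ge j+\max(j-i+1,0)+2j\,(m_{j+1}+\cdots+m_{k-1})\quad\text{if } m_j\ge 1,$$ and $\sum_{j=1}^{k-1}\sum_{l=1}^{m_j} n^{(j)}_l=n$, $\sum_{j=1}^{k-1} j\,m_j=m$. Then $F_{k,i}(n,m)=G_{k,i}(n,m)$ for all $n,m\ge 0$, and, as formal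 power series in $q$ and $z$ (with the multiple sum converging coefficientwise), $$\sum_{n,m\ge 0}F_{k,i}(n,m)\,q^nz^m=\sum_{n,m\ge 0}G_{k,i}(n,m)\,q^nz^m=\sum_{m_1,\dots,m_{k-1}=0}^{\infty}\frac{q^{N_1^2+\cdots+N_{k-1}^2+N_i+\cdots+N_{k-1}}\,z^{N_1+\cdots+N_{k-1}}}{(q)_{m_1}\cdots(q)_{m_{k-1}}},$$ where $N_j=m_j+\cdots+m_{k-1}$ and $(q)_r=\prod_{t=1}^{r}(1-q^t)$. (For $i=k$ the sum $N_i+\cdots+N_{k-1}$ is empty; for $k=1$ the multiple sum is the single term $1$.) -/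

import Mathlib

open scoped MvPowerSeries.WithPiTopology

/-- `IsRestricted k i p`: the sequence `p = (p_1, …, p_m)` (stored with indices `0, …, m - 1`) is a
partition, i.e. a weakly decreasing sequence of positive integers, such that
`p_l ≥ p_{l+k-1} + 2` whenever both indices are in range, and `p_{m-i+1} ≥ 2` if `i ≤ m`. -/
structure IsRestricted (k i : ℕ) {m : ℕ} (p : Fin m → ℕ) : Prop where
  antitone : Antitone p
  pos : ∀ l, 1 ≤ p l
  diff : ∀ l l' : Fin m, (l' : ℕ) = l + (k - 1) → p l' + 2 ≤ p l
  ones : ∀ l : Fin m, (l : ℕ) + i = m → 2 ≤ p l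

/-- The number `F_{k,i}(n,m)` of partitions of `n` into exactly `m` parts that satisfy
`IsRestricted k i`. -/
noncomputable def numF (k i n m : ℕ) : ℕ :=
  Nat.card {p : Fin m → ℕ // IsRestricted k i p ∧ ∑ l, p l = n}

/-- A tuple `(n^{(1)}, …, n^{(k-1)})` of finite sequences of arbitrary lengths `m_1, …, m_{k-1}`.
The index `j : Fin (k - 1)` stands for the superscript `j + 1`. -/
structure MultiSeq (k : ℕ) where
  len : Fin (k - 1) → ℕ
  part : ∀ j, Fin (len j) → ℕ

/-- The lower bound `j + max (j - i + 1, 0) + 2 j (m_{j+1} + ⋯ + m_{k-1})` at superscript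
`j + 1` in place of `j`; the truncated subtraction is the maximum with `0`. -/
def lowerBound {k : ℕ} (i : ℕ) (len : Fin (k - 1) → ℕ) (j : Fin (k - 1)) : ℕ :=
  ((j : ℕ) + 1) + (((j : ℕ) + 1) + 1 - i) + 2 * ((j : ℕ) + 1) * ∑ l ∈ Finset.Ioi j, len l

/-- The multiple partitions: `n^{(j)}_l ≥ n^{(j)}_{l+1} + 2 j`, and the last part of each nonempty
`n^{(j)}` is at least `lowerBound`. -/
structure IsMultiPartition {k : ℕ} (i : ℕ) (s : MultiSeq k) : Prop where
  diff : ∀ (j : Fin (k - 1)) (l l' : Fin (s.len j)), (l' : ℕ) = l + 1 →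
    s.part j l' + 2 * ((j : ℕ) + 1) ≤ s.part j l
  last : ∀ (j : Fin (k - 1)) (l : Fin (s.len j)), (l : ℕ) + 1 = s.len j →
    lowerBound i s.len j ≤ s.part j l

/-- The number `G_{k,i}(n,m)` of multiple partitions whose parts add up to `n` and whose lengths
satisfy `∑ j m_j = m`. -/
noncomputable def numG (k i n m : ℕ) : ℕ :=
  Nat.card {s : MultiSeq k // IsMultiPartition i s ∧
    (∑ j, ∑ l, s.part j l) = n ∧ (∑ j : Fin (k - 1), ((j : ℕ) + 1) * s.len j) = m}

/-- Formal power series in the two variables `q` and `z`. -/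
abbrev QZSeries : Type := MvPowerSeries (Fin 2) ℤ

noncomputable def qVar : QZSeries := MvPowerSeries.X 0

noncomputable def zVar : QZSeries := MvPowerSeries.X 1

/-- The formal series `∑ a(n,m) q^n z^m`. -/
def genSeries (a : ℕ → ℕ → ℕ) : QZSeries := fun d => (a (d 0) (d 1) : ℤ)

/-- `(q)_n = (1 - q)(1 - q²) ⋯ (1 - qⁿ)`. -/
noncomputable def qPoch (n : ℕ) : QZSeries := ∏ t ∈ Finset.range n, (1 - qVar ^ (t + 1))

/-- `N_j = m_j + m_{j+1} + ⋯ + m_{k-1}`. -/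
def tailSum {k : ℕ} (len : Fin (k - 1) → ℕ) (j : Fin (k - 1)) : ℕ := ∑ l ∈ Finset.Ici j, len l

/-- `N_1² + ⋯ + N_{k-1}² + N_i + ⋯ + N_{k-1}`. -/
def qExponent {k : ℕ} (i : ℕ) (len : Fin (k - 1) → ℕ) : ℕ :=
  (∑ j, tailSum len j ^ 2) +
    ∑ j ∈ Finset.univ.filter (fun j : Fin (k - 1) => i ≤ (j : ℕ) + 1), tailSum len j

/-- The denominator `(q)_{m_1} ⋯ (q)_{m_{k-1}}`. -/
noncomputable def denom {k : ℕ} (len : Fin (k - 1) → ℕ) : QZSeries := ∏ j, qPoch (len j)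

/-- The general term of the multiple sum. The denominator has constant term `1`, so
`MvPowerSeries.invOfUnit` is its inverse (see `denom_mul_inv`). -/
noncomputable def andrewsTerm {k : ℕ} (i : ℕ) (len : Fin (k - 1) → ℕ) : QZSeries :=
  qVar ^ qExponent i len * zVar ^ (∑ j, tailSum len j) * MvPowerSeries.invOfUnit (denom len) 1

theorem constantCoeff_denom {k : ℕ} (len : Fin (k - 1) → ℕ) :
    MvPowerSeries.constantCoeff (denom len) = 1 := by
  simp [denom, qPoch, qVar]

theorem denom_mul_inv {k : ℕ} (len : Fin (k - 1) → ℕ) :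
    denom len * MvPowerSeries.invOfUnit (denom len) 1 = 1 :=
  MvPowerSeries.mul_invOfUnit _ _ (by simp [constantCoeff_denom])

/-!
The generating functions `f_i(z)` of the restricted partitions form a Rogers–Selberg system,
`f_1(z) = f_k(z q)` and `f_{j+1}(z) = f_j(z) + (z q) ^ j f_{k-j}(z q)`, which together with
`f_i(0) = 1` determines them: a partition without ones, or with exactly `j` ones, is reduced by
subtracting `1` from every part.

The multiple sums solve the same system. In a sum with an arbitrary linear form in
`m_1, …, m_{k-1}` added to `N_1² + ⋯ + N_{k-1}²`, weighting the terms by `1 - q ^ m_j` cancels the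
last factor of `(q)_{m_j}`, and lowering `m_j` by one gives a sum with another linear form. Applied
to one index after the other, this exchange relation yields the second equation of the system; the
first one is the substitution `z ↦ z q`.

On the side of the multiple partitions, the excess of each sequence over its least admissible
values is arbitrary. For given lengths the minimal sum of the parts is the exponent of `q`, and the
excesses contribute `1 / ((q)_{m_1} ⋯ (q)_{m_{k-1}})`.
-/

section FiniteSums

theorem sum_mul_sum_Ici {ι R : Type*} [Fintype ι] [Preorder ι] [LocallyFiniteOrderTop ι]
    [LocallyFiniteOrderBot ι] [NonUnitalSemiring R] (f g : ι → R) :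
    ∑ l, f l * ∑ t ∈ Finset.Ici l, g t = ∑ t, (∑ l ∈ Finset.Iic t, f l) * g t := by
  simp_rw [Finset.mul_sum, Finset.sum_mul]
  exact Finset.sum_comm' fun l t => by simp

theorem sq_sum_eq_sum_mul_add_two_mul_sum_lt {ι R : Type*} [LinearOrder ι] [CommSemiring R]
    (s : Finset ι) (f : ι → R) :
    (∑ t ∈ s, f t) ^ 2 = ∑ t ∈ s, f t * (f t + 2 * ∑ u ∈ s with t < u, f u) := by
  induction s using Finset.induction_on_min with
  | empty => simp
  | insert a s ha ih =>
    have ha' : a ∉ s := fun h => lt_irrefl a (ha a h)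
    have hmin : {u ∈ insert a s | a < u} = s := by
      rw [Finset.filter_insert, if_neg (lt_irrefl a), Finset.filter_true_of_mem ha]
    have hrest (t) (ht : t ∈ s) : {u ∈ insert a s | t < u} = {u ∈ s | t < u} := by
      rw [Finset.filter_insert, if_neg (ha t ht).not_gt]
    have hsum : ∑ t ∈ s, f t * (f t + 2 * ∑ u ∈ insert a s with t < u, f u) =
        (∑ t ∈ s, f t) ^ 2 := by
      rw [ih]
      exact Finset.sum_congr rfl fun t ht => by rw [hrest t ht]
    rw [Finset.sum_insert ha', Finset.sum_insert ha', hmin, hsum]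
    ring

theorem sq_sum_Ici {ι R : Type*} [LinearOrder ι] [LocallyFiniteOrderTop ι] [CommSemiring R]
    (f : ι → R) (l : ι) :
    (∑ t ∈ Finset.Ici l, f t) ^ 2 =
      ∑ t ∈ Finset.Ici l, f t * (f t + 2 * ∑ u ∈ Finset.Ioi t, f u) := by
  rw [sq_sum_eq_sum_mul_add_two_mul_sum_lt]
  refine Finset.sum_congr rfl fun t ht => ?_
  have : {u ∈ Finset.Ici l | t < u} = Finset.Ioi t := by
    ext u
    simpa using fun h => (Finset.mem_Ici.1 ht).trans h.le
  rw [this]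

theorem finite_setOf_sum_mul_le {ι : Type*} [Fintype ι] {w : ι → ℕ} (hw : ∀ x, 1 ≤ w x) (n : ℕ) :
    {g : ι → ℕ | ∑ x, w x * g x ≤ n}.Finite :=
  (Set.Finite.pi' fun _ => Set.finite_Iic n).subset fun g hg x =>
    (Nat.le_mul_of_pos_left (g x) (hw x)).trans <|
      (Finset.single_le_sum (f := fun x => w x * g x) (fun _ _ => Nat.zero_le _)
        (Finset.mem_univ x)).trans hg

theorem card_filter_Iic_le_val_add_one {r i : ℕ} (hi : 1 ≤ i) (t : Fin r) :
    Finset.card {l ∈ Finset.Iic t | i ≤ ((l : Fin r) : ℕ) + 1} = (t : ℕ) + 2 - i := by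
  have hmap : Finset.map Fin.valEmbedding {l ∈ Finset.Iic t | i ≤ ((l : Fin r) : ℕ) + 1} =
      Finset.Icc (i - 1) (t : ℕ) := by
    ext x
    simp only [Finset.mem_map, Finset.mem_filter, Finset.mem_Iic, Fin.le_def,
      Fin.valEmbedding_apply, Finset.mem_Icc]
    constructor
    · rintro ⟨l, hl, rfl⟩
      omega
    · exact fun h => ⟨⟨x, by omega⟩, ⟨h.2, by grind⟩, rfl⟩
  rw [← Finset.card_map Fin.valEmbedding, hmap, Nat.card_Icc]
  omega

end FiniteSums

section ShiftedFamilies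

variable {ι : Type*}

theorem mem_range_add_single_one [DecidableEq ι] {g : ι → ℕ} {x : ι} (hg : g x ≠ 0) :
    g ∈ Set.range fun h : ι → ℕ => h + Pi.single x 1 := by
  refine ⟨g - Pi.single x 1, tsub_add_cancel_of_le fun y => ?_⟩
  obtain rfl | hy := eq_or_ne y x
  · simpa using Nat.one_le_iff_ne_zero.2 hg
  · simp [hy]

theorem hasSum_add_single_iff [DecidableEq ι] {M : Type*} [AddCommMonoid M] [TopologicalSpace M]
    {f : (ι → ℕ) → M} {a : M} (x : ι) (hf : ∀ g : ι → ℕ, g x = 0 → f g = 0) :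
    HasSum (fun g : ι → ℕ => f (g + Pi.single x 1)) a ↔ HasSum f a :=
  (add_left_injective (Pi.single x 1 : ι → ℕ)).hasSum_iff fun g hg =>
    hf g (not_not.1 (mt mem_range_add_single_one hg))

variable [Fintype ι] {R : Type*} [CommRing R] [TopologicalSpace R] [IsTopologicalRing R]
  {a : ι → R} {S : R}

/-- One factor at a time: the terms lost when `x` is adjoined to `s` are those with `g x ≠ 0`,
which are the translates of the others by a unit vector. -/
theorem hasSum_prod_pow_of_eqOn_zero [DecidableEq ι]
    (h : HasSum (fun g : ι → ℕ => ∏ x, a x ^ g x) S) (s : Finset ι) :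
    HasSum (fun g : ι → ℕ => if ∀ x ∈ s, g x = 0 then ∏ x, a x ^ g x else 0)
      ((∏ x ∈ s, (1 - a x)) * S) := by
  induction s using Finset.induction_on with
  | empty => simpa using h
  | insert x s hx ih =>
    have hlost : HasSum (fun g : ι → ℕ => (if ∀ y ∈ s, g y = 0 then ∏ y, a y ^ g y else 0) -
        if ∀ y ∈ insert x s, g y = 0 then ∏ y, a y ^ g y else 0)
        (a x * ((∏ y ∈ s, (1 - a y)) * S)) := by
      rw [← hasSum_add_single_iff x fun g hg => by simp [hg]]
      refine (ih.mul_left (a x)).congr_fun fun g => ?_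
      have hs : (∀ y ∈ s, (g + Pi.single x 1 : ι → ℕ) y = 0) ↔ ∀ y ∈ s, g y = 0 :=
        forall₂_congr fun y hy => by simp [ne_of_mem_of_not_mem hy hx]
      have hprod : ∏ y, a y ^ (g + Pi.single x 1 : ι → ℕ) y = a x * ∏ y, a y ^ g y := by
        simp only [Pi.add_apply, pow_add, Finset.prod_mul_distrib, Pi.single_apply, pow_ite]
        simp [mul_comm]
      simp only [hs, hprod, Finset.forall_mem_insert]
      simp
    simpa only [sub_sub_cancel, Finset.prod_insert hx, sub_mul, one_mul, mul_assoc]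
      using ih.sub hlost

theorem prod_one_sub_mul_eq_one_of_hasSum [T2Space R]
    (h : HasSum (fun g : ι → ℕ => ∏ x, a x ^ g x) S) : (∏ x, (1 - a x)) * S = 1 := by
  classical
  refine (hasSum_prod_pow_of_eqOn_zero h Finset.univ).unique ?_
  convert hasSum_single (0 : ι → ℕ) fun g hg => ?_ using 1
  · simp
  · exact if_neg fun hzero => hg (funext fun x => hzero x (Finset.mem_univ x))

end ShiftedFamilies

section Coefficients

open MvPowerSeries

/-- The exponent of the monomial `q ^ n * z ^ m`, as an index for coefficients. -/
noncomputable def qzExp (n m : ℕ) : Fin 2 →₀ ℕ := Finsupp.single 0 n + Finsupp.single 1 m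

@[simp]
theorem qzExp_apply_zero (n m : ℕ) : qzExp n m 0 = n := by simp [qzExp]

@[simp]
theorem qzExp_apply_one (n m : ℕ) : qzExp n m 1 = m := by simp [qzExp]

theorem qzExp_eta (d : Fin 2 →₀ ℕ) : qzExp (d 0) (d 1) = d := by
  ext x
  fin_cases x <;> simp

theorem qzExp_inj {a b n m : ℕ} : qzExp a b = qzExp n m ↔ a = n ∧ b = m := by
  simp [Finsupp.ext_iff]

theorem qzExp_le {a b n m : ℕ} : qzExp a b ≤ qzExp n m ↔ a ≤ n ∧ b ≤ m := by
  simp [Finsupp.le_def]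

theorem qzExp_sub (a b n m : ℕ) : qzExp n m - qzExp a b = qzExp (n - a) (m - b) := by
  ext x
  fin_cases x <;> simp

theorem hasSum_iff_hasSum_coeff_qzExp {α : Type*} {f : α → QZSeries} {a : QZSeries} :
    HasSum f a ↔ ∀ n m, HasSum (fun x => coeff (qzExp n m) (f x)) (coeff (qzExp n m) a) := by
  rw [WithPiTopology.hasSum_iff_hasSum_coeff]
  exact ⟨fun h n m => h _, fun h d => qzExp_eta d ▸ h (d 0) (d 1)⟩

@[simp]
theorem coeff_genSeries (a : ℕ → ℕ → ℕ) (n m : ℕ) :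
    coeff (qzExp n m) (genSeries a) = a n m := by
  simp [coeff_apply, genSeries]

theorem genSeries_injective : Function.Injective genSeries := fun a b h => by
  ext n m
  simpa using congrArg (coeff (qzExp n m)) h

theorem qVar_pow_mul_zVar_pow (a b : ℕ) :
    qVar ^ a * zVar ^ b = monomial (qzExp a b) (1 : ℤ) := by
  rw [qVar, zVar, X_pow_eq, X_pow_eq, monomial_mul_monomial, mul_one, qzExp]

theorem coeff_qVar_pow_mul_zVar_pow (a b n m : ℕ) :
    coeff (qzExp n m) (qVar ^ a * zVar ^ b) = if a = n ∧ b = m then 1 else 0 := by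
  classical
  simp only [qVar_pow_mul_zVar_pow, coeff_monomial, qzExp_inj, eq_comm]

theorem coeff_qVar_pow_mul_zVar_pow_mul (a b n m : ℕ) (f : QZSeries) :
    coeff (qzExp n m) (qVar ^ a * zVar ^ b * f) =
      if a ≤ n ∧ b ≤ m then coeff (qzExp (n - a) (m - b)) f else 0 := by
  simp only [qVar_pow_mul_zVar_pow, coeff_monomial_mul, qzExp_le, qzExp_sub, one_mul]

theorem hasSum_genSeries_card {α : Type*} (s t : α → ℕ)
    (hfin : ∀ n m, {x | s x = n ∧ t x = m}.Finite) :
    HasSum (fun x => qVar ^ s x * zVar ^ t x)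
      (genSeries fun n m => Nat.card {x // s x = n ∧ t x = m}) := by
  refine hasSum_iff_hasSum_coeff_qzExp.2 fun n m => ?_
  simp only [coeff_qVar_pow_mul_zVar_pow, coeff_genSeries]
  have hcard : (Nat.card {x // s x = n ∧ t x = m} : ℤ) =
      ∑ x ∈ (hfin n m).toFinset, if s x = n ∧ t x = m then 1 else 0 := by
    rw [Finset.sum_ite_of_true fun x hx =>
      show s x = n ∧ t x = m from (hfin n m).mem_toFinset.1 hx]
    rw [Finset.sum_const, nsmul_one, ← Nat.card_eq_card_finite_toFinset (hfin n m)]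
    rfl
  rw [hcard]
  exact hasSum_sum_of_ne_finset_zero fun x hx => if_neg fun h => hx ((hfin n m).mem_toFinset.2 h)

end Coefficients

section Denominators

open MvPowerSeries

variable {k : ℕ} (len : Fin (k - 1) → ℕ)

theorem eq_invOfUnit_denom {len : Fin (k - 1) → ℕ} {f : QZSeries} (h : denom len * f = 1) :
    f = invOfUnit (denom len) 1 :=
  left_inv_eq_right_inv (mul_comm (denom len) f ▸ h) (denom_mul_inv len)

theorem denom_eq_prod_sigma : denom len = ∏ x : Σ j, Fin (len j), (1 - qVar ^ ((x.2 : ℕ) + 1)) := by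
  simp only [denom, qPoch, Finset.prod_range, Fintype.prod_sigma]

theorem denom_add_single (j : Fin (k - 1)) :
    denom (len + Pi.single j 1) = denom len * (1 - qVar ^ (len j + 1)) := by
  have hfactor (x) : qPoch ((len + Pi.single j 1 : Fin (k - 1) → ℕ) x) =
      qPoch (len x) * if x = j then 1 - qVar ^ (len j + 1) else 1 := by
    obtain rfl | hx := eq_or_ne x j
    · simp [qPoch, Finset.prod_range_succ]
    · simp [hx]
  simp only [denom, hfactor, Finset.prod_mul_distrib]
  simp

theorem invOfUnit_denom_add_single (j : Fin (k - 1)) :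
    invOfUnit (denom (len + Pi.single j 1)) 1 * (1 - qVar ^ (len j + 1)) =
      invOfUnit (denom len) 1 := by
  refine eq_invOfUnit_denom ?_
  rw [mul_left_comm, ← denom_add_single, mul_comm, denom_mul_inv]

theorem hasSum_invOfUnit_denom :
    HasSum (fun g : (Σ j, Fin (len j)) → ℕ => qVar ^ ∑ x, ((x.2 : ℕ) + 1) * g x)
      (invOfUnit (denom len) 1) := by
  have hfin (n m : ℕ) :
      {g : (Σ j, Fin (len j)) → ℕ | ∑ x, ((x.2 : ℕ) + 1) * g x = n ∧ 0 = m}.Finite :=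
    (finite_setOf_sum_mul_le (fun x => x.2.val.succ_pos) n).subset fun _ hg => hg.1.le
  have hsum := hasSum_genSeries_card (fun g : (Σ j, Fin (len j)) → ℕ =>
    ∑ x, ((x.2 : ℕ) + 1) * g x) (fun _ => 0) hfin
  simp only [pow_zero, mul_one] at hsum
  convert hsum using 1
  refine (eq_invOfUnit_denom ?_).symm
  rw [denom_eq_prod_sigma]
  refine prod_one_sub_mul_eq_one_of_hasSum ?_
  simpa only [← pow_mul, Finset.prod_pow_eq_pow_sum] using hsum

theorem coeff_invOfUnit_denom_eq_zero (n : ℕ) {m : ℕ} (hm : m ≠ 0) :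
    coeff (qzExp n m) (invOfUnit (denom len) 1) = 0 := by
  refine (hasSum_iff_hasSum_coeff_qzExp.1 (hasSum_invOfUnit_denom len) n m).unique ?_
  convert hasSum_zero (α := ℤ) with g
  simpa [hm.symm] using coeff_qVar_pow_mul_zVar_pow (∑ x, ((x.2 : ℕ) + 1) * g x) 0 n m

end Denominators

section MultipleSums

open MvPowerSeries

variable {k : ℕ}

/-- The number `N_1 + ⋯ + N_{k-1} = ∑ j m_j` that is the exponent of `z`. -/
def zExponent (len : Fin (k - 1) → ℕ) : ℕ := ∑ j : Fin (k - 1), ((j : ℕ) + 1) * len j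

theorem sum_tailSum_Iic (len : Fin (k - 1) → ℕ) (j : Fin (k - 1)) :
    ∑ l ∈ Finset.Iic j, tailSum len l = ∑ t : Fin (k - 1), (min (t : ℕ) j + 1) * len t := by
  have h := sum_mul_sum_Ici (fun l => if l ≤ j then 1 else 0) len
  simp only [ite_mul, one_mul, zero_mul, ← Finset.sum_filter, Finset.filter_ge_eq_Iic] at h
  refine h.trans (Finset.sum_congr rfl fun t _ => ?_)
  have : {l ∈ Finset.Iic t | l ≤ j} = Finset.Iic (min t j) := by ext; simp
  simp [this]

theorem sum_tailSum (len : Fin (k - 1) → ℕ) : ∑ j, tailSum len j = zExponent len := by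
  simpa [tailSum, zExponent] using sum_mul_sum_Ici (fun _ => 1) len

theorem tailSum_add_single (len : Fin (k - 1) → ℕ) (j l : Fin (k - 1)) :
    tailSum (len + Pi.single j 1) l = tailSum len l + if l ≤ j then 1 else 0 := by
  simp [tailSum, Finset.sum_add_distrib]

theorem sum_sq_tailSum_add_single (len : Fin (k - 1) → ℕ) (j : Fin (k - 1)) :
    ∑ l, tailSum (len + Pi.single j 1) l ^ 2 =
      ∑ l, tailSum len l ^ 2 + ∑ t : Fin (k - 1), 2 * (min (t : ℕ) j + 1) * len t + (j + 1) := by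
  simp only [mul_assoc, ← Finset.mul_sum]
  rw [← sum_tailSum_Iic, ← Fin.card_Iic j, Finset.card_eq_sum_ones, Finset.mul_sum, add_assoc,
    ← Finset.sum_add_distrib, ← Finset.filter_ge_eq_Iic, Finset.sum_filter,
    ← Finset.sum_add_distrib]
  refine Finset.sum_congr rfl fun l _ => ?_
  rw [tailSum_add_single]
  split_ifs <;> ring

/-- The term `q ^ (∑ N_j² + ∑ b_j m_j) z ^ (∑ N_j) / ((q)_{m_1} ⋯ (q)_{m_{k-1}})` of a multiple
sum with an arbitrary linear form in `m_1, …, m_{k-1}` in the exponent. -/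
noncomputable def gordonTerm (b : Fin (k - 1) → ℕ) (len : Fin (k - 1) → ℕ) : QZSeries :=
  qVar ^ (∑ j, tailSum len j ^ 2 + ∑ j, b j * len j) * zVar ^ zExponent len *
    invOfUnit (denom len) 1

/-- The multiple sum `∑ gordonTerm b len` over all `len`. -/
noncomputable def gordonSum (b : Fin (k - 1) → ℕ) : QZSeries := ∑' len, gordonTerm b len

theorem le_zExponent (len : Fin (k - 1) → ℕ) (j : Fin (k - 1)) : len j ≤ zExponent len :=
  (Nat.le_mul_of_pos_left _ j.val.succ_pos).trans
    (Finset.single_le_sum (f := fun j : Fin (k - 1) => ((j : ℕ) + 1) * len j)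
      (fun _ _ => Nat.zero_le _) (Finset.mem_univ j))

theorem finite_zExponent_eq (m : ℕ) : {len : Fin (k - 1) → ℕ | zExponent len = m}.Finite :=
  (finite_setOf_sum_mul_le (fun j => j.val.succ_pos) m).subset fun _ hlen => hlen.le

theorem coeff_gordonTerm (b len : Fin (k - 1) → ℕ) (n m : ℕ) :
    coeff (qzExp n m) (gordonTerm b len) =
      if zExponent len = m ∧ ∑ j, tailSum len j ^ 2 + ∑ j, b j * len j ≤ n then
        coeff (qzExp (n - (∑ j, tailSum len j ^ 2 + ∑ j, b j * len j)) 0) (invOfUnit (denom len) 1)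
      else 0 := by
  rw [gordonTerm, coeff_qVar_pow_mul_zVar_pow_mul]
  obtain rfl | hm := eq_or_ne (zExponent len) m
  · simp
  · rw [if_neg (mt And.left hm), ite_eq_right_iff]
    exact fun h => coeff_invOfUnit_denom_eq_zero len _ (by omega)

theorem summable_gordonTerm (b : Fin (k - 1) → ℕ) : Summable (gordonTerm b) := by
  refine WithPiTopology.summable_iff_summable_coeff.2 fun d => ?_
  rw [← qzExp_eta d]
  refine summable_of_hasFiniteSupport ((finite_zExponent_eq (d 1)).subset fun len hlen => ?_)
  rw [Function.mem_support, coeff_gordonTerm] at hlen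
  exact (ite_ne_right_iff.1 hlen).1.1

theorem hasSum_gordonTerm (b : Fin (k - 1) → ℕ) : HasSum (gordonTerm b) (gordonSum b) :=
  (summable_gordonTerm b).hasSum

theorem hasSum_coeff_gordonTerm (b : Fin (k - 1) → ℕ) (n m : ℕ) :
    HasSum (fun len => coeff (qzExp n m) (gordonTerm b len)) (coeff (qzExp n m) (gordonSum b)) :=
  hasSum_iff_hasSum_coeff_qzExp.1 (hasSum_gordonTerm b) n m

theorem coeff_gordonSum_zero (b : Fin (k - 1) → ℕ) (n : ℕ) :
    coeff (qzExp n 0) (gordonSum b) = if n = 0 then 1 else 0 := by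
  have hzero : gordonTerm b 0 = 1 := by
    simpa [gordonTerm, tailSum, zExponent, denom, qPoch] using denom_mul_inv (0 : Fin (k - 1) → ℕ)
  have hsingle := hasSum_single (f := fun len => coeff (qzExp n 0) (gordonTerm b len)) 0
    fun len hlen => by
      rw [coeff_gordonTerm, if_neg]
      exact fun h => hlen (funext fun j => Nat.le_zero.1 (h.1 ▸ le_zExponent len j))
  rw [(hasSum_coeff_gordonTerm b n 0).unique hsingle, hzero]
  simpa [eq_comm] using coeff_qVar_pow_mul_zVar_pow 0 0 n 0

/-- Replacing `b_j` by `b_j + j` is the substitution `z ↦ z q`. -/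
theorem coeff_gordonSum_add_one (b : Fin (k - 1) → ℕ) (n m : ℕ) :
    coeff (qzExp n m) (gordonSum fun l => b l + (l + 1)) =
      if m ≤ n then coeff (qzExp (n - m) m) (gordonSum b) else 0 := by
  have hexp (len : Fin (k - 1) → ℕ) :
      ∑ j, (b j + (j + 1)) * len j = ∑ j, b j * len j + zExponent len := by
    simp only [zExponent, add_mul, Finset.sum_add_distrib]
  have hterm (len : Fin (k - 1) → ℕ) :
      coeff (qzExp n m) (gordonTerm (fun l => b l + (l + 1)) len) =
        if m ≤ n then coeff (qzExp (n - m) m) (gordonTerm b len) else 0 := by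
    simp only [coeff_gordonTerm, hexp]
    grind
  refine (hasSum_coeff_gordonTerm _ n m).unique ?_
  simp only [hterm]
  split_ifs
  · exact hasSum_coeff_gordonTerm b (n - m) m
  · exact hasSum_zero

theorem qExponent_eq {i : ℕ} (hi : 1 ≤ i) (len : Fin (k - 1) → ℕ) :
    qExponent i len =
      ∑ j, tailSum len j ^ 2 + ∑ j : Fin (k - 1), ((j : ℕ) + 2 - i) * len j := by
  have h := sum_mul_sum_Ici (fun l : Fin (k - 1) => if i ≤ (l : ℕ) + 1 then 1 else 0) len
  simp only [ite_mul, one_mul, zero_mul, ← Finset.sum_filter, ← Finset.card_eq_sum_ones,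
    card_filter_Iic_le_val_add_one hi] at h
  rw [qExponent, ← h]
  rfl

theorem andrewsTerm_eq_gordonTerm {i : ℕ} (hi : 1 ≤ i) (len : Fin (k - 1) → ℕ) :
    andrewsTerm i len = gordonTerm (fun j => j + 2 - i) len := by
  rw [andrewsTerm, gordonTerm, qExponent_eq hi, sum_tailSum]

end MultipleSums

section Exchange

variable {k : ℕ}

theorem zExponent_add_single (len : Fin (k - 1) → ℕ) (j : Fin (k - 1)) :
    zExponent (len + Pi.single j 1) = zExponent len + (j + 1) := by
  simp [zExponent, mul_add, Finset.sum_add_distrib, Pi.single_apply]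

theorem gordonTerm_add_single (b len : Fin (k - 1) → ℕ) (j : Fin (k - 1)) :
    gordonTerm (b + Pi.single j 1) len = qVar ^ len j * gordonTerm b len := by
  have h : ∑ l, (b + Pi.single j 1 : Fin (k - 1) → ℕ) l * len l = ∑ l, b l * len l + len j := by
    simp [add_mul, Finset.sum_add_distrib, Pi.single_apply]
  rw [gordonTerm, gordonTerm, h]
  ring

theorem one_sub_mul_gordonTerm_add_single (b len : Fin (k - 1) → ℕ) (j : Fin (k - 1)) :
    (1 - qVar ^ (len j + 1)) * gordonTerm b (len + Pi.single j 1) =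
      qVar ^ (j + 1 + b j) * zVar ^ ((j : ℕ) + 1) *
        gordonTerm (fun l => b l + 2 * (min (l : ℕ) j + 1)) len := by
  have h : ∑ l, b l * (len + Pi.single j 1 : Fin (k - 1) → ℕ) l = ∑ l, b l * len l + b j := by
    simp [mul_add, Finset.sum_add_distrib, Pi.single_apply]
  simp only [gordonTerm, h, sum_sq_tailSum_add_single, zExponent_add_single,
    ← invOfUnit_denom_add_single len j, add_mul, Finset.sum_add_distrib]
  ring

/-- The sum of the terms weighted by `1 - q ^ m_j`: those with `m_j = 0` vanish, and lowering `m_j`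
by one in the others gives a multiple sum of the same kind. -/
theorem gordonSum_eq_add (b : Fin (k - 1) → ℕ) (j : Fin (k - 1)) :
    gordonSum b = gordonSum (b + Pi.single j 1) + qVar ^ (j + 1 + b j) * zVar ^ ((j : ℕ) + 1) *
      gordonSum fun l => b l + 2 * (min (l : ℕ) j + 1) := by
  have hdiff : HasSum (fun len => (1 - qVar ^ len j) * gordonTerm b len)
      (gordonSum b - gordonSum (b + Pi.single j 1)) := by
    have hterm (len : Fin (k - 1) → ℕ) : (1 - qVar ^ len j) * gordonTerm b len =
        gordonTerm b len - gordonTerm (b + Pi.single j 1) len := by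
      rw [gordonTerm_add_single, sub_mul, one_mul]
    simp only [hterm]
    exact (hasSum_gordonTerm b).sub (hasSum_gordonTerm (b + Pi.single j 1))
  have hshift := (hasSum_add_single_iff j fun len hlen => by simp [hlen]).2 hdiff
  simp only [Pi.add_apply, Pi.single_eq_same, one_sub_mul_gordonTerm_add_single] at hshift
  rw [← sub_eq_iff_eq_add']
  exact hshift.unique ((hasSum_gordonTerm _).mul_left _)

end Exchange

section StepForms

variable {k : ℕ}

/-- The linear form `l ↦ c l + max (l - j, 0)` on the superscripts `l ≤ r`, continued by `B`; a
superscript `l` is stored as `l - 1`. For `r = k - 1` and `c = 0` it is the form in `andrewsTerm`,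
and raising `c` by one is the substitution `z ↦ z q`. -/
def stepForm (c j r : ℕ) (B : Fin (k - 1) → ℕ) (l : Fin (k - 1)) : ℕ :=
  if (l : ℕ) < r then c * (l + 1) + (l + 1 - j) else B l

theorem stepForm_succ (c : ℕ) {j d : ℕ} {r : Fin (k - 1)} (hd : r + 1 - j = d)
    (B : Fin (k - 1) → ℕ) :
    stepForm c j (r + 1) B = stepForm c j r (Function.update B r (c * (r + 1) + d)) := by
  funext l
  obtain rfl | hl := eq_or_ne l r
  · simp [stepForm, hd]
  · simp [stepForm, hl, le_iff_lt_or_eq, Fin.val_inj]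

theorem gordonSum_stepForm_update (c j : ℕ) (r : Fin (k - 1)) (B : Fin (k - 1) → ℕ) (b : ℕ) :
    gordonSum (stepForm c j r (Function.update B r b)) =
      gordonSum (stepForm c j r (Function.update B r (b + 1))) +
        qVar ^ (r + 1 + b) * zVar ^ ((r : ℕ) + 1) *
          gordonSum (stepForm (c + 2) j r fun l => Function.update B r b l + 2 * (r + 1)) := by
  have hsingle : stepForm c j r (Function.update B r b) + Pi.single r 1 =
      stepForm c j r (Function.update B r (b + 1)) := by
    funext l
    obtain rfl | hl := eq_or_ne l r <;> simp [stepForm, *]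
  have hmin : (fun l => stepForm c j r (Function.update B r b) l + 2 * (min (l : ℕ) r + 1)) =
      stepForm (c + 2) j r fun l => Function.update B r b l + 2 * (r + 1) := by
    funext l
    simp only [stepForm]
    split_ifs <;> grind
  rw [gordonSum_eq_add _ r, hsingle, hmin]
  simp [stepForm]

theorem gordonSum_stepForm_last (c : ℕ) (r : Fin (k - 1)) (B : Fin (k - 1) → ℕ) :
    gordonSum (stepForm c (r + 1) (r + 1) B) = gordonSum (stepForm c r (r + 1) B) +
      qVar ^ ((r + 1) * (c + 1)) * zVar ^ ((r : ℕ) + 1) *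
        gordonSum (stepForm (c + 1) 0 (r + 1) fun l => B l + 2 * (r + 1)) := by
  have hsingle : stepForm c (r + 1) (r + 1) B + Pi.single r 1 = stepForm c r (r + 1) B := by
    funext l
    simp only [stepForm, Pi.add_apply, Pi.single_apply, Fin.ext_iff]
    grind
  have hmin : (fun l => stepForm c (r + 1) (r + 1) B l + 2 * (min (l : ℕ) r + 1)) =
      stepForm (c + 1) 0 (r + 1) fun l => B l + 2 * (r + 1) := by
    funext l
    simp only [stepForm]
    grind
  have hr : r + 1 + stepForm c (r + 1) (r + 1) B r = (r + 1) * (c + 1) := by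
    simp only [stepForm, lt_add_one, if_true, Nat.sub_self, add_zero]
    ring
  rw [gordonSum_eq_add _ r, hsingle, hmin, hr]

/-- The exchange at the last index `r` turns two instances of the recursion for `r`, with `j` and
`s` interchanged in one of them, into an instance for `r + 1`. -/
theorem gordonSum_stepForm (r : ℕ) (hr : r ≤ k - 1) (c j s : ℕ) (hjs : j + s + 1 = r)
    (B : Fin (k - 1) → ℕ) :
    gordonSum (stepForm c (j + 1) r B) = gordonSum (stepForm c j r B) +
      qVar ^ ((j + 1) * (c + 1)) * zVar ^ (j + 1) *
        gordonSum (stepForm (c + 1) s r fun l => B l + 2 * (j + 1)) := by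
  induction r generalizing c j s B with
  | zero => omega
  | succ r ih =>
    obtain ⟨x, rfl⟩ : ∃ x : Fin (k - 1), (x : ℕ) = r := ⟨⟨r, hr⟩, rfl⟩
    obtain _ | s := s
    · obtain rfl : j = x := by omega
      exact gordonSum_stepForm_last c x B
    · have hx : (x : ℕ) = j + s + 1 := by omega
      obtain ⟨B', hB'⟩ : ∃ B', B' = Function.update B x (c * (x + 1) + (s + 1)) := ⟨_, rfl⟩
      have hright : (stepForm (c + 1) (s + 1) (x + 1) fun l => B l + 2 * (j + 1)) =
          stepForm (c + 1) (s + 1) x fun l => B' l + 2 * (j + 1) := by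
        rw [stepForm_succ (c + 1) (show (x : ℕ) + 1 - (s + 1) = j + 1 by omega)]
        congr 1
        funext l
        obtain rfl | hl := eq_or_ne l x
        · rw [hB', Function.update_self, Function.update_self, hx]
          ring
        · simp [hB', hl]
      have hboth : (fun l => B' l + 2 * (j + 1) + 2 * (s + 1)) = fun l => B' l + 2 * (x + 1) := by
        funext l
        omega
      have hj := ih (by omega) c j s hx.symm B'
      have hs := ih (by omega) (c + 1) s j (by omega) fun l => B' l + 2 * (j + 1)
      have hexchange := gordonSum_stepForm_update c j x B (c * (x + 1) + (s + 1))
      rw [hboth, show c + 1 + 1 = c + 2 from rfl] at hs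
      rw [← hB'] at hexchange
      rw [stepForm_succ c (show (x : ℕ) + 1 - (j + 1) = s + 1 by omega), ← hB', hj, hexchange,
        stepForm_succ c (show (x : ℕ) + 1 - j = s + 1 + 1 by omega),
        ← add_assoc _ (s + 1) 1, hright, hs, hx]
      ring

end StepForms

section RogersSelberg

open MvPowerSeries

/-- The coefficientwise form of the Rogers–Selberg system `f_1(z) = f_k(z q)`,
`f_{j+1}(z) = f_j(z) + (z q) ^ j f_{k-j}(z q)` with `f_i(0) = 1`, where `c i n m` is the coefficient
of `q ^ n z ^ m` in `f_i`. -/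
structure IsRogersSelbergSystem (k : ℕ) (c : ℕ → ℕ → ℕ → ℤ) : Prop where
  zero : ∀ i n, c i n 0 = if n = 0 then 1 else 0
  one : ∀ n m, c 1 n m = if m ≤ n then c k (n - m) m else 0
  succ : ∀ j n m, 1 ≤ j → j < k →
    c (j + 1) n m = c j n m + if j ≤ m ∧ m ≤ n then c (k - j) (n - m) (m - j) else 0

theorem IsRogersSelbergSystem.unique {k : ℕ} {c d : ℕ → ℕ → ℕ → ℤ}
    (hc : IsRogersSelbergSystem k c) (hd : IsRogersSelbergSystem k d) {i : ℕ} (hi : 1 ≤ i)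
    (hik : i ≤ k) (n m : ℕ) : c i n m = d i n m := by
  induction n using Nat.strong_induction_on generalizing m i with
  | _ n ihn =>
    obtain rfl | hm := Nat.eq_zero_or_pos m
    · rw [hc.zero, hd.zero]
    have hlower {i'} (hi' : 1 ≤ i') (hik' : i' ≤ k) (hmn : m ≤ n) (m') :
        c i' (n - m) m' = d i' (n - m) m' := ihn (n - m) (by omega) hi' hik' m'
    induction i, hi using Nat.le_induction with
    | base =>
      rw [hc.one, hd.one]
      exact ite_congr rfl (fun h => hlower hik le_rfl h m) fun _ => rfl
    | succ j hj ihj =>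
      rw [hc.succ j n m hj hik, hd.succ j n m hj hik, ihj (by omega)]
      exact congrArg _ (ite_congr rfl (fun h => hlower (by omega) (by omega) h.2 _) fun _ => rfl)

/-- The multiple sum of the theorem, i.e. the sum of all `andrewsTerm i len`. -/
noncomputable def andrewsSum (k i : ℕ) : QZSeries :=
  gordonSum fun j : Fin (k - 1) => (j : ℕ) + 2 - i

theorem hasSum_andrewsTerm (k : ℕ) {i : ℕ} (hi : 1 ≤ i) :
    HasSum (fun len : Fin (k - 1) → ℕ => andrewsTerm i len) (andrewsSum k i) := by
  simp only [andrewsTerm_eq_gordonTerm hi]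
  exact hasSum_gordonTerm _

theorem coeff_andrewsSum_one (k n m : ℕ) : coeff (qzExp n m) (andrewsSum k 1) =
    if m ≤ n then coeff (qzExp (n - m) m) (andrewsSum k k) else 0 := by
  rw [andrewsSum, andrewsSum, ← coeff_gordonSum_add_one]
  congr! 3 with l
  omega

theorem andrewsSum_succ {k j : ℕ} (hj : 1 ≤ j) (hjk : j < k) :
    andrewsSum k (j + 1) = andrewsSum k j + qVar ^ j * zVar ^ j *
      gordonSum fun l : Fin (k - 1) => (l + 2 - (k - j)) + ((l : ℕ) + 1) := by
  obtain ⟨j, rfl⟩ := Nat.exists_eq_add_of_le' hj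
  have hform (c i : ℕ) (B) : stepForm c i (k - 1) B =
      fun l : Fin (k - 1) => ((l : ℕ) + 2 - (i + 1)) + c * (l + 1) := by
    funext l
    simp [stepForm, add_comm]
  have h := gordonSum_stepForm (k - 1) le_rfl 0 j (k - (j + 2)) (by omega) 0
  have hs : k - (j + 2) + 1 = k - (j + 1) := by omega
  simpa only [hform, hs, andrewsSum, zero_mul, zero_add, add_zero, one_mul, mul_one] using h

theorem coeff_andrewsSum_succ {k j : ℕ} (hj : 1 ≤ j) (hjk : j < k) (n m : ℕ) :
    coeff (qzExp n m) (andrewsSum k (j + 1)) = coeff (qzExp n m) (andrewsSum k j) +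
      if j ≤ m ∧ m ≤ n then coeff (qzExp (n - m) (m - j)) (andrewsSum k (k - j)) else 0 := by
  rw [andrewsSum_succ hj hjk, map_add, coeff_qVar_pow_mul_zVar_pow_mul, coeff_gordonSum_add_one,
    ← andrewsSum]
  have h (hjm : j ≤ m) : n - j - (m - j) = n - m := by omega
  grind

theorem isRogersSelbergSystem_coeff_andrewsSum (k : ℕ) :
    IsRogersSelbergSystem k fun i n m => coeff (qzExp n m) (andrewsSum k i) where
  zero _ n := coeff_gordonSum_zero _ n
  one := coeff_andrewsSum_one k
  succ _ n m hj hjk := coeff_andrewsSum_succ hj hjk n m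

end RogersSelberg

section Restricted

/-- The sequence obtained by adding `1` to every entry and then appending `j` entries equal to `1`.
It inverts the removal of the first column of the diagram of a partition with `j` ones. -/
def addOnes {m : ℕ} (j : ℕ) (p : Fin m → ℕ) : Fin (m + j) → ℕ :=
  Fin.append (fun l => p l + 1) fun _ => 1

@[simp]
theorem addOnes_castAdd {m : ℕ} (j : ℕ) (p : Fin m → ℕ) (l : Fin m) :
    addOnes j p (Fin.castAdd j l) = p l + 1 :=
  Fin.append_left _ _ l

theorem addOnes_of_lt {m : ℕ} (j : ℕ) (p : Fin m → ℕ) {l : Fin (m + j)} (h : (l : ℕ) < m) :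
    addOnes j p l = p ⟨l, h⟩ + 1 :=
  addOnes_castAdd j p ⟨l, h⟩

theorem addOnes_of_le {m : ℕ} (j : ℕ) (p : Fin m → ℕ) {l : Fin (m + j)} (h : m ≤ (l : ℕ)) :
    addOnes j p l = 1 := by
  simp [addOnes, Fin.append, Fin.addCases, h.not_gt]

theorem one_le_addOnes {m : ℕ} (j : ℕ) (p : Fin m → ℕ) (l : Fin (m + j)) : 1 ≤ addOnes j p l := by
  obtain h | h := lt_or_ge (l : ℕ) m
  · exact addOnes_of_lt j p h ▸ Nat.le_add_left _ _
  · exact (addOnes_of_le j p h).ge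

theorem sum_addOnes {m : ℕ} (j : ℕ) (p : Fin m → ℕ) :
    ∑ l, addOnes j p l = ∑ l, p l + (m + j) := by
  simp [addOnes, Fin.sum_univ_add, Finset.sum_add_distrib, add_assoc]

theorem addOnes_injective {m : ℕ} (j : ℕ) :
    Function.Injective (addOnes j : (Fin m → ℕ) → Fin (m + j) → ℕ) := by
  intro p p' h
  funext l
  simpa using congrFun h (Fin.castAdd j l)

theorem mem_range_addOnes_iff {m j : ℕ} {p : Fin (m + j) → ℕ} (hpos : ∀ l, 1 ≤ p l) :
    p ∈ Set.range (addOnes j) ↔ ∀ l : Fin (m + j), m ≤ l → p l = 1 := by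
  constructor
  · rintro ⟨p, rfl⟩ l hl
    exact addOnes_of_le j p hl
  · refine fun h => ⟨fun l => p (Fin.castAdd j l) - 1, funext fun l => ?_⟩
    obtain hl | hl := lt_or_ge (l : ℕ) m
    · rw [addOnes_of_lt _ _ hl]
      exact Nat.sub_add_cancel (hpos l)
    · rw [addOnes_of_le _ _ hl, h l hl]

variable {k i j m : ℕ}

theorem isRestricted_addOnes (hjk : j < k) {p : Fin m → ℕ} (hp : IsRestricted k (k - j) p) :
    IsRestricted k (j + 1) (addOnes j p) where
  antitone l l' hl := by
    obtain h' | h' := lt_or_ge (l' : ℕ) m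
    · have h : (l : ℕ) < m := lt_of_le_of_lt hl h'
      rw [addOnes_of_lt j p h', addOnes_of_lt j p h]
      exact Nat.succ_le_succ (hp.antitone hl)
    · exact addOnes_of_le j p h' ▸ one_le_addOnes j p l
  pos := one_le_addOnes j p
  diff l l' hl := by
    have h : (l : ℕ) < m := by omega
    rw [addOnes_of_lt j p h]
    obtain h' | h' := lt_or_ge (l' : ℕ) m
    · rw [addOnes_of_lt j p h']
      have := hp.diff ⟨l, h⟩ ⟨l', h'⟩ hl
      omega
    · rw [addOnes_of_le j p h']
      have htwo : 2 ≤ p ⟨m - (k - j), by omega⟩ := hp.ones _ (Nat.sub_add_cancel (by omega))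
      have hle : p ⟨m - (k - j), by omega⟩ ≤ p ⟨l, h⟩ := hp.antitone (Fin.mk_le_mk.2 (by omega))
      omega
  ones l hl := by
    have h : (l : ℕ) < m := by omega
    rw [addOnes_of_lt j p h]
    exact Nat.succ_le_succ (hp.pos ⟨l, h⟩)

theorem isRestricted_of_addOnes {p : Fin m → ℕ} (hp : IsRestricted k (j + 1) (addOnes j p)) :
    IsRestricted k (k - j) p where
  antitone l l' hl := by
    simpa using hp.antitone (show Fin.castAdd j l ≤ Fin.castAdd j l' from hl)
  pos l := by
    have hl := l.2
    have hlast := hp.ones ⟨m - 1, by omega⟩ (by simp only; omega)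
    have hle : Fin.castAdd j l ≤ ⟨m - 1, by omega⟩ :=
      Fin.mk_le_mk.2 (Nat.le_sub_one_of_lt hl)
    simpa using hlast.trans (hp.antitone hle)
  diff l l' hl := by
    simpa [add_right_comm] using hp.diff (Fin.castAdd j l) (Fin.castAdd j l') hl
  ones l hl := by
    have hdiff := hp.diff (Fin.castAdd j l) ⟨l + (k - 1), by omega⟩ rfl
    have hpos := hp.pos ⟨l + (k - 1), by omega⟩
    rw [addOnes_castAdd] at hdiff
    omega

theorem isRestricted_addOnes_iff (hjk : j < k) {p : Fin m → ℕ} :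
    IsRestricted k (j + 1) (addOnes j p) ↔ IsRestricted k (k - j) p :=
  ⟨isRestricted_of_addOnes, isRestricted_addOnes hjk⟩

namespace IsRestricted

theorem succ {p : Fin m → ℕ} (hi : 1 ≤ i) (hp : IsRestricted k i p) :
    IsRestricted k (i + 1) p where
  __ := hp
  ones l hl := (hp.ones ⟨l + 1, by omega⟩ (by simp only; omega)).trans
    (hp.antitone (Fin.mk_le_mk.2 (Nat.le_succ _)))

theorem of_succ_of_lt {p : Fin m → ℕ} (hm : m < i) (hp : IsRestricted k (i + 1) p) :
    IsRestricted k i p where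
  __ := hp
  ones l hl := by omega

theorem mem_range_addOnes_iff_not (hj : 1 ≤ j) {p : Fin (m + j) → ℕ}
    (hp : IsRestricted k (j + 1) p) :
    p ∈ Set.range (addOnes j) ↔ ¬ IsRestricted k j p := by
  let last : Fin (m + j) := ⟨m, by omega⟩
  have hrange : p ∈ Set.range (addOnes j) ↔ p last = 1 := by
    rw [mem_range_addOnes_iff hp.pos]
    exact ⟨fun h => h last le_rfl,
      fun h l hl => (hp.antitone (Fin.mk_le_mk.2 hl)).trans h.le |>.antisymm (hp.pos l)⟩
  have hj : IsRestricted k j p ↔ 2 ≤ p last := by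
    refine ⟨fun h => h.ones last rfl, fun h => { hp with ones := fun l hl => ?_ }⟩
    rwa [show l = last from Fin.ext (by simp only [last]; omega)]
  have := hp.pos last
  rw [hrange, hj]
  omega

end IsRestricted

/-- The set of partitions counted by `numF k i n m`. -/
def restrictedPartitions (k i n m : ℕ) : Set (Fin m → ℕ) :=
  {p | IsRestricted k i p ∧ ∑ l, p l = n}

theorem finite_restrictedPartitions (k i n m : ℕ) : (restrictedPartitions k i n m).Finite := by
  refine (finite_setOf_sum_mul_le (w := 1) (fun _ => le_rfl) n).subset ?_
  rintro p ⟨-, hp⟩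
  simp [hp]

theorem numF_eq_ncard (k i n m : ℕ) : numF k i n m = (restrictedPartitions k i n m).ncard := rfl

theorem ncard_restrictedPartitions_inter_range_addOnes {k j : ℕ} (hjk : j < k) (n m : ℕ) :
    (restrictedPartitions k (j + 1) n (m + j) ∩ Set.range (addOnes j)).ncard =
      if m + j ≤ n then numF k (k - j) (n - (m + j)) m else 0 := by
  have hpreimage : addOnes j ⁻¹' restrictedPartitions k (j + 1) n (m + j) =
      {p : Fin m → ℕ | IsRestricted k (k - j) p ∧ ∑ l, p l + (m + j) = n} := by
    ext p
    simp [restrictedPartitions, isRestricted_addOnes_iff hjk, sum_addOnes]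
  rw [← Set.image_preimage_eq_inter_range, Set.ncard_image_of_injective _ (addOnes_injective j),
    hpreimage]
  split_ifs with h
  · simp only [numF_eq_ncard, restrictedPartitions, eq_tsub_iff_add_eq_of_le h]
  · convert Set.ncard_empty (Fin m → ℕ)
    exact Set.eq_empty_of_forall_notMem fun p hp => h (hp.2 ▸ Nat.le_add_left _ _)

theorem numF_zero (k i n : ℕ) : numF k i n 0 = if n = 0 then 1 else 0 := by
  have hempty (p : Fin 0 → ℕ) : IsRestricted k i p :=
    ⟨Subsingleton.antitone p, fun l => l.elim0, fun l => l.elim0, fun l => l.elim0⟩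
  obtain rfl | hn := eq_or_ne n 0
  · simp [numF, hempty]
  · simp [numF, hn, hn.symm]

theorem numF_one {k : ℕ} (hk : 1 ≤ k) (n m : ℕ) :
    numF k 1 n m = if m ≤ n then numF k k (n - m) m else 0 := by
  have hrange : restrictedPartitions k 1 n (m + 0) ⊆ Set.range (addOnes 0) := fun p hp =>
    (mem_range_addOnes_iff hp.1.pos).2 fun l hl => absurd l.2 hl.not_gt
  have hcard := ncard_restrictedPartitions_inter_range_addOnes hk n m
  rwa [Set.inter_eq_left.2 hrange] at hcard

theorem numF_succ {k j : ℕ} (hj : 1 ≤ j) (hjk : j < k) (n m : ℕ) :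
    numF k (j + 1) n m =
      numF k j n m + if j ≤ m ∧ m ≤ n then numF k (k - j) (n - m) (m - j) else 0 := by
  obtain hmj | hjm := lt_or_ge m j
  · rw [if_neg (by omega), add_zero, numF_eq_ncard, numF_eq_ncard]
    congr 1 with p
    exact and_congr_left' ⟨.of_succ_of_lt hmj, .succ hj⟩
  · obtain ⟨m, rfl⟩ := Nat.exists_eq_add_of_le' hjm
    have hdiff : restrictedPartitions k (j + 1) n (m + j) \ Set.range (addOnes j) =
        restrictedPartitions k j n (m + j) := by
      ext p
      constructor
      · rintro ⟨⟨hp, hsum⟩, hrange⟩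
        exact ⟨not_not.1 (mt (hp.mem_range_addOnes_iff_not hj).2 hrange), hsum⟩
      · rintro ⟨hp, hsum⟩
        have hp' := hp.succ hj
        exact ⟨⟨hp', hsum⟩, fun hrange => (hp'.mem_range_addOnes_iff_not hj).1 hrange hp⟩
    rw [numF_eq_ncard k (j + 1), ← Set.ncard_inter_add_ncard_sdiff_eq_ncard _
      (Set.range (addOnes j)) (finite_restrictedPartitions k (j + 1) n (m + j)),
      ncard_restrictedPartitions_inter_range_addOnes hjk, hdiff, add_comm, numF_eq_ncard k j]
    simp only [hjm, true_and, Nat.add_sub_cancel]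

theorem isRogersSelbergSystem_numF {k : ℕ} (hk : 1 ≤ k) :
    IsRogersSelbergSystem k fun i n m => (numF k i n m : ℤ) where
  zero i n := by exact_mod_cast numF_zero k i n
  one n m := by exact_mod_cast numF_one hk n m
  succ j n m hj hjk := by exact_mod_cast numF_succ hj hjk n m

theorem hasSum_andrewsTerm_genSeries_numF {k i : ℕ} (hi : 1 ≤ i) (hik : i ≤ k) :
    HasSum (fun len : Fin (k - 1) → ℕ => andrewsTerm i len) (genSeries (numF k i)) := by
  have hcoeff := (isRogersSelbergSystem_numF (hi.trans hik)).unique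
    (isRogersSelbergSystem_coeff_andrewsSum k) hi hik
  have heq : genSeries (numF k i) = andrewsSum k i := by
    ext d
    rw [← qzExp_eta d, coeff_genSeries, hcoeff]
  exact heq ▸ hasSum_andrewsTerm k hi

end Restricted

section Gapped

variable {M : ℕ} (b e : ℕ)

/-- The sequences satisfying the conditions that `IsMultiPartition` imposes on `n^{(e)}`, for a
fixed lower bound `b` of the last entry. -/
structure IsGapped (p : Fin M → ℕ) : Prop where
  diff : ∀ l l' : Fin M, (l' : ℕ) = l + 1 → p l' + 2 * e ≤ p l
  last : ∀ l : Fin M, (l : ℕ) + 1 = M → b ≤ p l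

/-- The sequence whose last entry exceeds `b`, and whose consecutive differences exceed `2 * e`,
by the entries of `g`. -/
def gapSeq (g : Fin M → ℕ) (l : Fin M) : ℕ :=
  b + 2 * e * (M - 1 - l) + ∑ t ∈ Finset.Ici l, g t

theorem gapSeq_of_succ (g : Fin M → ℕ) {l l' : Fin M} (h : (l' : ℕ) = l + 1) :
    gapSeq b e g l = gapSeq b e g l' + 2 * e + g l := by
  have hIoi : Finset.Ioi l = Finset.Ici l' := by
    ext t
    simp only [Finset.mem_Ioi, Finset.mem_Ici, Fin.lt_def, Fin.le_def]
    omega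
  have hsub : M - 1 - (l : ℕ) = M - 1 - l' + 1 := by omega
  rw [gapSeq, gapSeq, ← Finset.add_sum_Ioi_eq_sum_Ici, hIoi, hsub]
  ring

theorem gapSeq_of_last (g : Fin M → ℕ) {l : Fin M} (h : (l : ℕ) + 1 = M) :
    gapSeq b e g l = b + g l := by
  have hIci : Finset.Ici l = {l} := by
    ext t
    simp only [Finset.mem_Ici, Finset.mem_singleton, Fin.le_def, Fin.ext_iff]
    omega
  have hsub : M - 1 - (l : ℕ) = 0 := by omega
  simp [gapSeq, hIci, hsub]

theorem gapSeq_injective : Function.Injective (gapSeq b e : (Fin M → ℕ) → Fin M → ℕ) := by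
  intro g g' h
  funext l
  have hl := congrFun h l
  obtain hM | hM := eq_or_ne ((l : ℕ) + 1) M
  · simpa [gapSeq_of_last b e _ hM] using hl
  · have hsucc : ((⟨l + 1, by omega⟩ : Fin M) : ℕ) = l + 1 := rfl
    simpa [gapSeq_of_succ b e _ hsucc, h] using hl

theorem isGapped_gapSeq (g : Fin M → ℕ) : IsGapped b e (gapSeq b e g) where
  diff _ _ h := gapSeq_of_succ b e g h ▸ Nat.le_add_right _ _
  last _ h := gapSeq_of_last b e g h ▸ Nat.le_add_right _ _

variable {b e}

theorem IsGapped.exists_gapSeq_eq {p : Fin M → ℕ} (hp : IsGapped b e p) :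
    ∃ g, gapSeq b e g = p := by
  refine ⟨fun l => p l - if h : (l : ℕ) + 1 < M then p ⟨l + 1, h⟩ + 2 * e else b, ?_⟩
  funext l
  induction l using WellFoundedGT.induction with
  | _ l ih =>
    obtain hM | hM := eq_or_ne ((l : ℕ) + 1) M
    · rw [gapSeq_of_last _ _ _ hM, dif_neg hM.not_lt]
      exact Nat.add_sub_cancel' (hp.last l hM)
    · have hlt : (l : ℕ) + 1 < M := by omega
      rw [gapSeq_of_succ (l' := ⟨l + 1, hlt⟩) _ _ _ rfl, dif_pos hlt,
        ih ⟨l + 1, hlt⟩ (Fin.mk_lt_mk.2 (Nat.lt_succ_self _))]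
      exact Nat.add_sub_cancel' (hp.diff l ⟨l + 1, hlt⟩ rfl)

variable (M b e)

/-- The gaps of a sequence with prescribed minimal gaps can be chosen freely. -/
noncomputable def gapEquiv : (Fin M → ℕ) ≃ {p : Fin M → ℕ // IsGapped b e p} :=
  .ofBijective (fun g => ⟨gapSeq b e g, isGapped_gapSeq b e g⟩)
    ⟨fun _ _ h => gapSeq_injective b e (congrArg Subtype.val h), fun p =>
      p.2.exists_gapSeq_eq.imp fun _ hg => Subtype.ext hg⟩

variable {M}

theorem sum_gapSeq (g : Fin M → ℕ) :
    ∑ l, gapSeq b e g l = M * b + e * (M * (M - 1)) + ∑ t : Fin M, ((t : ℕ) + 1) * g t := by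
  have htriangle : 2 * ∑ l : Fin M, (M - 1 - (l : ℕ)) = M * (M - 1) := by
    rw [Fin.sum_univ_eq_sum_range (fun l => M - 1 - l), Finset.sum_range_reflect (fun l => l),
      mul_comm, Finset.sum_range_id_mul_two]
  have hgaps : ∑ l, ∑ t ∈ Finset.Ici l, g t = ∑ t : Fin M, ((t : ℕ) + 1) * g t := by
    simpa using sum_mul_sum_Ici (fun _ => 1) g
  simp only [gapSeq, Finset.sum_add_distrib, hgaps, ← Finset.mul_sum, ← htriangle,
    Finset.sum_const, Finset.card_univ, Fintype.card_fin, smul_eq_mul]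
  ring

end Gapped

section MultiPartitions

variable {k : ℕ} (i : ℕ)

theorem isMultiPartition_iff {s : MultiSeq k} :
    IsMultiPartition i s ↔ ∀ j, IsGapped (lowerBound i s.len j) (j + 1) (s.part j) :=
  ⟨fun h j => ⟨h.diff j, h.last j⟩, fun h => ⟨fun j => (h j).diff, fun j => (h j).last⟩⟩

/-- A multiple partition is determined by its lengths and its gaps, which are arbitrary. -/
noncomputable def multiGapEquiv :
    (Σ len : Fin (k - 1) → ℕ, (Σ j, Fin (len j)) → ℕ) ≃ {s : MultiSeq k // IsMultiPartition i s} :=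
  (Equiv.sigmaCongrRight fun len => (Equiv.piCurry fun _ _ => ℕ).trans <|
    (Equiv.piCongrRight fun j => gapEquiv (len j) (lowerBound i len j) (j + 1)).trans
      Equiv.subtypePiEquivPi.symm).trans
  { toFun x := ⟨⟨x.1, x.2.1⟩, (isMultiPartition_iff i).2 x.2.2⟩
    invFun s := ⟨s.1.len, s.1.part, (isMultiPartition_iff i).1 s.2⟩ }

theorem sum_lowerBound {i : ℕ} (hi : 1 ≤ i) (len : Fin (k - 1) → ℕ) :
    ∑ j : Fin (k - 1), (len j * lowerBound i len j + (j + 1) * (len j * (len j - 1))) =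
      qExponent i len := by
  rw [qExponent_eq hi]
  have hsq : ∑ j, tailSum len j ^ 2 = ∑ j : Fin (k - 1),
      ((j : ℕ) + 1) * (len j * (len j + 2 * ∑ t ∈ Finset.Ioi j, len t)) := by
    simp only [tailSum, sq_sum_Ici]
    simpa using sum_mul_sum_Ici (fun _ => 1) fun j =>
      len j * (len j + 2 * ∑ t ∈ Finset.Ioi j, len t)
  rw [hsq, ← Finset.sum_add_distrib]
  refine Finset.sum_congr rfl fun j _ => ?_
  have hsub : len j * len j = len j + len j * (len j - 1) := by
    rw [Nat.mul_sub_one, Nat.add_sub_cancel' (Nat.le_mul_self _)]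
  rw [lowerBound, mul_add (len j) (len j), hsub]
  ring

theorem sum_part_multiGapEquiv {i : ℕ} (hi : 1 ≤ i)
    (x : Σ len : Fin (k - 1) → ℕ, (Σ j, Fin (len j)) → ℕ) :
    ∑ j, ∑ l, (multiGapEquiv i x).1.part j l =
      qExponent i x.1 + ∑ y, ((y.2 : ℕ) + 1) * x.2 y := by
  obtain ⟨len, g⟩ := x
  change ∑ j, ∑ l, gapSeq (lowerBound i len j) (j + 1) (fun l => g ⟨j, l⟩) l = _
  simp only [sum_gapSeq]
  rw [Finset.sum_add_distrib, sum_lowerBound hi, Fintype.sum_sigma]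

theorem numG_eq_card {i : ℕ} (hi : 1 ≤ i) (n m : ℕ) :
    numG k i n m = Nat.card {x : Σ len : Fin (k - 1) → ℕ, (Σ j, Fin (len j)) → ℕ //
      qExponent i x.1 + ∑ y, ((y.2 : ℕ) + 1) * x.2 y = n ∧ zExponent x.1 = m} := by
  refine Nat.card_congr ((Equiv.subtypeSubtypeEquivSubtypeInter _ _).symm.trans
    ((multiGapEquiv i).subtypeEquiv fun x => ?_).symm)
  rw [sum_part_multiGapEquiv hi]
  rfl

theorem hasSum_andrewsTerm_genSeries_numG (k : ℕ) {i : ℕ} (hi : 1 ≤ i) :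
    HasSum (fun len : Fin (k - 1) → ℕ => andrewsTerm i len) (genSeries (numG k i)) := by
  have hfin (n m : ℕ) : {x : Σ len : Fin (k - 1) → ℕ, (Σ j, Fin (len j)) → ℕ |
      qExponent i x.1 + ∑ y, ((y.2 : ℕ) + 1) * x.2 y = n ∧ zExponent x.1 = m}.Finite := by
    refine ((finite_zExponent_eq m).toFinset.sigma fun len => (finite_setOf_sum_mul_le
      (fun y : Σ j, Fin (len j) => y.2.val.succ_pos) n).toFinset).finite_toSet.subset fun x hx => ?_
    simp only [Finset.mem_coe, Finset.mem_sigma, Set.Finite.mem_toFinset]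
    exact ⟨hx.2, (Nat.le_add_left _ _).trans hx.1.le⟩
  have hsum := hasSum_genSeries_card _ _ hfin
  simp only [← numG_eq_card hi] at hsum
  refine hsum.sigma fun len => ?_
  simp only [pow_add, andrewsTerm, sum_tailSum, mul_right_comm _ (zVar ^ _)]
  exact ((hasSum_invOfUnit_denom len).mul_left _).mul_right _

end MultiPartitions

theorem mainTheorem3 (k i : ℕ) (hi : 1 ≤ i) (hik : i ≤ k) :
    HasSum (fun len : Fin (k - 1) → ℕ => andrewsTerm i len) (genSeries (numF k i)) ∧
    HasSum (fun len : Fin (k - 1) → ℕ => andrewsTerm i len) (genSeries (numG k i)) ∧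
    ∀ n m : ℕ, numF k i n m = numG k i n m := by
  have hF := hasSum_andrewsTerm_genSeries_numF hi hik
  have hG := hasSum_andrewsTerm_genSeries_numG k hi
  exact ⟨hF, hG, congrFun₂ (genSeries_injective (hF.unique hG))⟩
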